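/- Let $n\ge 2$ and let all indices be taken modulo $n$. Let $CB_n$ be the circular braid group, i.e. the braid group of the annulus on $n$ strands, given by its presentation with generators $\sigma_1,\dots,\sigma_n,\zeta$ and relations $$\sigma_i\sigma_{i+1}\sigma_i=\sigma_{i+1}\sigma_i\sigma_{i+1}\ \text{ for all } i\ (\text{only if } n\ge 3),\qquad \sigma_i\sigma_j=\sigma_j\sigma_i\ \text{ if } i-j\not\equiv\pm1 \pmod n,\qquad \zeta^{-1}\sigma_i\zeta=\sigma_{i+1}\ \text{ for all } i.$$ Let $F_n$ be the free group on $x_1,\dots,x_n$, and let $\operatorname{Aut}F_n$ be the group of its automorphisms, composed from left to right ($fg$ means first $f$, then $g$). Let $\rho_{CB}:CB_n\to\operatorname{Aut}F_n$ be the (well defined) homomorphism such that $$\rho_{CB}(\sigma_i):\ x_i\mapsto x_ix_{i+1}x_i^{-1},\quad x_{i+1}\mapsto x_i,\quad x_j\mapsto x_j\ (j\ne i,i+1),\qquad\qquad \rho_{CB}(\zeta):\ x_j\mapsto x_{j+1}.$$ Then the kernel of $\rho_{CB}$ is the cyclic subgroup of $CB_n$ generated by $\zeta^n$. -/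

import Mathlib

/-- The generators `σ i` (with `i` an index modulo `n`) and `ζ` of the circular braid group. -/
inductive CBGen (n : ℕ) : Type
  | sigma (i : ZMod n) : CBGen n
  | zeta : CBGen n

namespace CBGen

/-- `σ i` as a word in the generators. -/
def s {n : ℕ} (i : ZMod n) : FreeGroup (CBGen n) := FreeGroup.of (sigma i)

/-- `ζ` as a word in the generators. -/
def z {n : ℕ} : FreeGroup (CBGen n) := FreeGroup.of zeta

end CBGen

open CBGen in
/-- The relators of the circular braid group on `n` strands; all indices are modulo `n`.
The braid relation between the cyclically adjacent generators `σ i` and `σ (i + 1)` is present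
for `3 ≤ n` only: for `n = 2` the two generators are adjacent on both sides, and they satisfy no
braid relation in the braid group of the annulus. -/
inductive CBRel (n : ℕ) : FreeGroup (CBGen n) → Prop
  | braid (hn : 3 ≤ n) (i : ZMod n) :
      CBRel n ((s i * s (i + 1) * s i) * (s (i + 1) * s i * s (i + 1))⁻¹)
  | comm (i j : ZMod n) (h₁ : j ≠ i + 1) (h₂ : i ≠ j + 1) :
      CBRel n ((s i * s j) * (s j * s i)⁻¹)
  | shift (i : ZMod n) : CBRel n ((z⁻¹ * s i * z) * (s (i + 1))⁻¹)

/-- The circular braid group `CB_n` (the braid group of the annulus on `n` strands). -/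
abbrev CircularBraidGroup (n : ℕ) : Type := PresentedGroup {r | CBRel n r}

namespace CircularBraidGroup

/-- The element `σ i` of `CB_n`. -/
def sigma {n : ℕ} (i : ZMod n) : CircularBraidGroup n := PresentedGroup.of (CBGen.sigma i)

/-- The element `ζ` of `CB_n`. -/
def zeta (n : ℕ) : CircularBraidGroup n := PresentedGroup.of CBGen.zeta

end CircularBraidGroup

/-- The free group `F_n`, with free generators `x j` indexed by the integers `j` modulo `n`. -/
abbrev Fn (n : ℕ) : Type := FreeGroup (ZMod n)

namespace Fn

variable {n : ℕ}

/-- The `j`-th free generator of `F_n`. -/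
def x (j : ZMod n) : Fn n := FreeGroup.of j

theorem hom_ext {f g : Fn n →* Fn n} (h : ∀ j, f (x j) = g (x j)) : f = g :=
  FreeGroup.ext_hom f g h

theorem aut_ext {f g : MulAut (Fn n)} (h : ∀ j, f (x j) = g (x j)) : f = g := by
  have : f.toMonoidHom = g.toMonoidHom := hom_ext h
  ext w
  exact DFunLike.congr_fun this w

/-- The Artin endomorphism `x i ↦ x i * x (i + 1) * (x i)⁻¹`, `x (i + 1) ↦ x i`, and `x j ↦ x j`
for the other `j`. -/
def artinHom (i : ZMod n) : Fn n →* Fn n :=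
  FreeGroup.lift fun j =>
    if j = i then x i * x (i + 1) * (x i)⁻¹ else if j = i + 1 then x i else x j

/-- The inverse of `artinHom i`. -/
def artinInvHom (i : ZMod n) : Fn n →* Fn n :=
  FreeGroup.lift fun j =>
    if j = i + 1 then (x (i + 1))⁻¹ * x i * x (i + 1) else if j = i then x (i + 1) else x j

theorem artinHom_x (i j : ZMod n) : artinHom i (x j) =
    if j = i then x i * x (i + 1) * (x i)⁻¹ else if j = i + 1 then x i else x j :=
  FreeGroup.lift_apply_of

theorem artinInvHom_x (i j : ZMod n) : artinInvHom i (x j) =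
    if j = i + 1 then (x (i + 1))⁻¹ * x i * x (i + 1) else if j = i then x (i + 1) else x j :=
  FreeGroup.lift_apply_of

/-- The Artin automorphism `artinHom i` as an element of `Aut F_n`. -/
def artinAut (i : ZMod n) : MulAut (Fn n) :=
  MonoidHom.toMulEquiv (artinHom i) (artinInvHom i)
    (hom_ext fun j => by
      simp only [MonoidHom.comp_apply, MonoidHom.id_apply, artinHom_x]
      by_cases h : (1 : ZMod n) = 0 <;> split_ifs <;>
        simp_all [artinInvHom_x, mul_assoc])
    (hom_ext fun j => by
      simp only [MonoidHom.comp_apply, MonoidHom.id_apply, artinInvHom_x]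
      by_cases h : (1 : ZMod n) = 0 <;> split_ifs <;>
        simp_all [artinHom_x, mul_assoc])

theorem artinAut_x (i j : ZMod n) : artinAut i (x j) =
    if j = i then x i * x (i + 1) * (x i)⁻¹ else if j = i + 1 then x i else x j :=
  artinHom_x i j

/-- The automorphism `x j ↦ x (j + 1)` of `F_n`. -/
def shiftAut (n : ℕ) : MulAut (Fn n) := FreeGroup.freeGroupCongr (Equiv.addRight 1)

theorem shiftAut_x (j : ZMod n) : shiftAut n (x j) = x (j + 1) := by
  simp [shiftAut, x]

end Fn

/-- The images of the generators of `CB_n`. Automorphisms are composed from left to right (the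
product `f g` is "first `f`, then `g`"), hence the opposite of Mathlib's `MulAut`; with the other
order the relation `ζ⁻¹ σ i ζ = σ (i + 1)` would not be respected. -/
def rhoCBGen (n : ℕ) : CBGen n → (MulAut (Fn n))ᵐᵒᵖ
  | .sigma i => MulOpposite.op (Fn.artinAut i)
  | .zeta => MulOpposite.op (Fn.shiftAut n)

theorem rhoCBGen_rel (n : ℕ) : ∀ r ∈ {r | CBRel n r}, FreeGroup.lift (rhoCBGen n) r = 1 := by
  rintro r hr
  cases hr with
  | braid hn i =>
    have h1 : (1 : ZMod n) ≠ 0 := by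
      have : Fact (1 < n) := ⟨by omega⟩
      exact one_ne_zero
    have h2 : (2 : ZMod n) ≠ 0 := by
      intro h
      have : ((2 : ℕ) : ZMod n) = 0 := by exact_mod_cast h
      rw [ZMod.natCast_eq_zero_iff] at this
      exact absurd (Nat.le_of_dvd (by norm_num) this) (by omega)
    rw [map_mul, map_inv, mul_inv_eq_one]
    simp only [map_mul, CBGen.s, FreeGroup.lift_apply_of, rhoCBGen, ← MulOpposite.op_mul]
    congr 1
    have e1 : i + 1 ≠ i := by simpa using h1
    have e2 : i + 1 + 1 ≠ i := by
      rw [add_assoc, one_add_one_eq_two]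
      simpa using h2
    have e3 : i + 1 + 1 ≠ i + 1 := by simpa using h1
    have e4 := e2.symm
    have e5 := e1.symm
    have e6 := e3.symm
    refine Fn.aut_ext fun j => ?_
    simp only [MulAut.mul_apply]
    by_cases hj : j = i
    · subst hj; simp [Fn.artinAut_x, *, mul_assoc]
    by_cases hj' : j = i + 1
    · subst hj'; simp [Fn.artinAut_x, *, mul_assoc]
    by_cases hj'' : j = i + 1 + 1
    · subst hj''; simp [Fn.artinAut_x, *]
    simp [Fn.artinAut_x, *]
  | comm i j h₁ h₂ =>
    rw [map_mul, map_inv, mul_inv_eq_one]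
    simp only [map_mul, CBGen.s, FreeGroup.lift_apply_of, rhoCBGen, ← MulOpposite.op_mul]
    congr 1
    by_cases hij : i = j
    · rw [hij]
    have e1 : i + 1 ≠ j + 1 := by grind
    have e2 : j + 1 ≠ i + 1 := by grind
    have e3 : j ≠ i := fun h => hij h.symm
    have e4 := h₁.symm
    have e5 := h₂.symm
    refine Fn.aut_ext fun k => ?_
    simp only [MulAut.mul_apply, Fn.artinAut_x]
    split_ifs <;> simp_all [Fn.artinAut_x]
  | shift i =>
    rw [map_mul, map_inv, mul_inv_eq_one]
    simp only [map_mul, map_inv, CBGen.s, CBGen.z, FreeGroup.lift_apply_of, rhoCBGen]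
    rw [mul_assoc, inv_mul_eq_iff_eq_mul]
    simp only [← MulOpposite.op_mul]
    congr 1
    refine Fn.aut_ext fun k => ?_
    simp only [MulAut.mul_apply, Fn.artinAut_x, Fn.shiftAut_x]
    split_ifs <;> simp_all [Fn.shiftAut_x]

/-- The representation `ρ_CB : CB_n → Aut F_n`, with automorphisms composed from left to right. -/
def rhoCB (n : ℕ) : CircularBraidGroup n →* (MulAut (Fn n))ᵐᵒᵖ :=
  PresentedGroup.toGroup (rhoCBGen_rel n)

theorem rhoCB_sigma {n : ℕ} (i : ZMod n) :
    rhoCB n (CircularBraidGroup.sigma i) = MulOpposite.op (Fn.artinAut i) :=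
  PresentedGroup.toGroup.of (rhoCBGen_rel n)

theorem rhoCB_zeta (n : ℕ) :
    rhoCB n (CircularBraidGroup.zeta n) = MulOpposite.op (Fn.shiftAut n) :=
  PresentedGroup.toGroup.of (rhoCBGen_rel n)

/-! `CB_n` factors as `U * B`, with `U` normal. Here `B` is the braid group generated by all the `σ
i` but one, and `U` is the image of `F_n` under a map `conjHom` for which `w` acts on `F_n` as the
inner automorphism `y ↦ w⁻¹ y w`. If `u * γ` acts trivially, with `u` coming from `w`, then `w`
commutes with the product `P` of all free generators, because `γ` fixes `P`. Since `P` belongs to a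
basis, `w = P ^ l`. The winding number of `P ^ l * γ` is `n * l`, as is that of `ζ ^ (n * l)`, which
also acts trivially. Dividing by the latter leaves a kernel element of winding number `0`, hence one
in `B`, and `B` acts faithfully by Artin's theorem (`eq_one_of_act_eq_one`).

Artin's theorem is proved by combing. Both it and the factorization rest on the same fact about
Artin groups of type `B`: the conjugates of the special generator `A` generate a subgroup normalized
by the braid generators (`closure_le_normalizer`). It is applied to `A = s k ^ 2` for combing and to
`A = lastInner n` for `CB_n`. -/

/-! ### Braid sequences, type `B` relations and coset representatives -/

/-- The braid relations among the first `k` terms of a sequence of group elements. -/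
structure IsBraidSeq {G : Type*} [Group G] (s : ℕ → G) (k : ℕ) : Prop where
  braid : ∀ i, i + 1 < k → s i * s (i + 1) * s i = s (i + 1) * s i * s (i + 1)
  comm : ∀ i j, i + 1 < j → j < k → Commute (s i) (s j)

/-- The relations which an element `A` has to satisfy in order to extend a braid sequence to the
generators of an Artin group of type `B`. -/
structure IsTypeB {G : Type*} [Group G] (s : ℕ → G) (k : ℕ) (A : G) : Prop
    extends IsBraidSeq s k where
  comm_last : ∀ j, j + 1 < k → Commute (s j) A
  four : ∀ j, j + 1 = k → A * s j * A * s j = s j * A * s j * A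

namespace BraidSeq

variable {G : Type*} [Group G]

/-- The descending product `s (k - 1) * ⋯ * s (i + 1) * s i`. -/
def desc (s : ℕ → G) (k i : ℕ) : G := ((List.range' i (k - i)).reverse.map s).prod

theorem desc_self (s : ℕ → G) (k : ℕ) : desc s k k = 1 := by simp [desc]

theorem desc_eq_mul (s : ℕ → G) {k i : ℕ} (h : i < k) : desc s k i = desc s k (i + 1) * s i := by
  obtain ⟨l, rfl⟩ := Nat.exists_eq_add_of_lt h
  simp [desc, show i + l + 1 - i = l + 1 by omega, show i + l + 1 - (i + 1) = l by omega,
    List.range'_succ]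

theorem desc_succ (s : ℕ → G) {k i : ℕ} (h : i ≤ k) : desc s (k + 1) i = s k * desc s k i := by
  obtain ⟨l, rfl⟩ := Nat.exists_eq_add_of_le h
  simp [desc, show i + l + 1 - i = l + 1 by omega, List.range'_concat]

/-- The conjugates of `A` by the descending products. -/
def conj (s : ℕ → G) (k : ℕ) (A : G) (i : ℕ) : G := (desc s k i)⁻¹ * A * desc s k i

theorem conj_self (s : ℕ → G) (k : ℕ) (A : G) : conj s k A k = A := by simp [conj, desc_self]

theorem conj_eq (s : ℕ → G) {k i : ℕ} (A : G) (h : i < k) :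
    conj s k A i = (s i)⁻¹ * conj s k A (i + 1) * s i := by
  simp [conj, desc_eq_mul s h, mul_assoc]

theorem desc_mem_closure (s : ℕ → G) (k i : ℕ) :
    desc s k i ∈ Subgroup.closure (s '' {j | j < k}) := by
  refine Subgroup.list_prod_mem _ fun y hy => ?_
  simp only [List.mem_map, List.mem_reverse, List.mem_range'] at hy
  obtain ⟨_, ⟨j, hj, rfl⟩, rfl⟩ := hy
  exact Subgroup.subset_closure ⟨_, by simp only [Set.mem_ofPred_eq]; omega, rfl⟩

variable {s : ℕ → G} {k : ℕ} {A : G}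

theorem commute_desc (h : IsBraidSeq s k) {i j : ℕ} (hi : i ≤ k) (hj : j + 1 < i) :
    Commute (s j) (desc s k i) := by
  induction hi using Nat.decreasingInduction with
  | self => simp [desc_self]
  | of_succ i hi ih =>
    rw [desc_eq_mul s hi]
    exact (ih (by omega)).mul_right (h.comm _ _ hj hi)

theorem desc_mul_succ (h : IsBraidSeq s k) {i j : ℕ} (hij : i ≤ j) (hj : j + 1 < k) :
    desc s k i * s (j + 1) = s j * desc s k i := by
  induction hij using Nat.decreasingInduction with
  | self =>
    rw [desc_eq_mul s (by omega : j < k), desc_eq_mul s hj]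
    have h1 := (commute_desc h (i := j + 1 + 1) (j := j) (by omega) (by omega)).eq
    calc desc s k (j + 1 + 1) * s (j + 1) * s j * s (j + 1)
        = desc s k (j + 1 + 1) * (s (j + 1) * s j * s (j + 1)) := by group
      _ = desc s k (j + 1 + 1) * s j * s (j + 1) * s j := by rw [← h.braid j hj]; group
      _ = _ := by rw [← h1]; group
  | of_succ i hi' ih =>
    rw [desc_eq_mul s (by omega : i < k), mul_assoc, (h.comm i (j + 1) (by omega) hj).eq,
      ← mul_assoc, ih, mul_assoc]

theorem commute_conj_of_lt (h : IsTypeB s k A) {i j : ℕ} (hi : i ≤ k) (hj : j + 1 < i) :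
    Commute (s j) (conj s k A i) := by
  have h1 := commute_desc h.toIsBraidSeq hi hj
  exact (h1.inv_right.mul_right (h.comm_last j (by omega))).mul_right h1

/-- By `desc_mul_succ`, `s j` is the conjugate of `s (j - 1)` by the descending product that also
defines `conj s k A i`, so the claim reduces to `s (j - 1)` commuting with `A`. -/
theorem commute_conj_of_gt (h : IsTypeB s k A) {i j : ℕ} (hi : i < j) (hj : j < k) :
    Commute (s j) (conj s k A i) := by
  obtain ⟨j, rfl⟩ : ∃ l, j = l + 1 := ⟨j - 1, by omega⟩
  have h1 := desc_mul_succ h.toIsBraidSeq (Nat.lt_succ_iff.mp hi) hj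
  have h2 := (h.comm_last j hj).eq
  have h3 : s (j + 1) = (desc s k i)⁻¹ * s j * desc s k i := by
    rw [mul_assoc, ← h1]; group
  rw [h3]
  unfold conj
  show _ = _
  calc _ = (desc s k i)⁻¹ * (s j * A) * desc s k i := by group
    _ = _ := by rw [h2]; group

theorem mul_mul_inv_of_braid {s t : G} (hb : s * t * s = t * s * t) :
    t * s * t⁻¹ = s⁻¹ * t * s := by
  rw [mul_inv_eq_iff_eq_mul, mul_assoc, mul_assoc, eq_inv_mul_iff_mul_eq, ← mul_assoc, hb,
    mul_assoc]

/-- The inductive step of `conj_four`. The braid relation rewrites `t * s * t⁻¹` as `s⁻¹ * t * s`,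
and the outer `s` factors pass through `A`, which exposes one instance of `h4`. -/
theorem four_step {t A s : G} (hb : s * t * s = t * s * t) (hA : Commute s A)
    (h4 : A * t * A * t = t * A * t * A) :
    (t⁻¹ * A * t) * s * (t⁻¹ * A * t) * s = s * (t⁻¹ * A * t) * s * (t⁻¹ * A * t) := by
  have e1 := mul_mul_inv_of_braid hb
  have e2 : s * t⁻¹ * s⁻¹ = t⁻¹ * s⁻¹ * t := by
    simpa [mul_assoc] using congrArg (·⁻¹) (mul_mul_inv_of_braid hb.symm)
  have e3 : A * s⁻¹ = s⁻¹ * A := hA.inv_left.eq.symm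
  calc _ = t⁻¹ * A * (t * s * t⁻¹) * A * t * s := by group
    _ = t⁻¹ * (A * s⁻¹) * t * (s * A) * t * s := by rw [e1]; group
    _ = t⁻¹ * s⁻¹ * A * t * A * (s * t * s) := by rw [e3, hA.eq]; group
    _ = t⁻¹ * s⁻¹ * (A * t * A * t) * s * t := by rw [hb]; group
    _ = (t⁻¹ * s⁻¹ * t) * A * t * (A * s) * t := by rw [h4]; group
    _ = s * t⁻¹ * (s⁻¹ * A) * t * s * A * t := by rw [← e2, ← hA.eq]; group
    _ = s * t⁻¹ * A * (s⁻¹ * t * s) * A * t := by rw [← e3]; group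
    _ = _ := by rw [← e1]; group

theorem conj_four (h : IsTypeB s k A) {i : ℕ} (hi : i < k) :
    conj s k A (i + 1) * s i * conj s k A (i + 1) * s i =
      s i * conj s k A (i + 1) * s i * conj s k A (i + 1) := by
  have hi' : i ≤ k - 1 := by omega
  induction hi' using Nat.decreasingInduction with
  | self =>
    rw [Nat.sub_add_cancel (by omega), conj_self]
    exact h.four _ (by omega)
  | of_succ i hi' ih =>
    rw [conj_eq s A (by omega : i + 1 < k)]
    exact four_step (h.braid i (by omega)) (commute_conj_of_lt h (by omega) (by omega))
      (ih (by omega))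

/-- The subgroup generated by the conjugates of `A`. -/
def conjSubgroup (s : ℕ → G) (k : ℕ) (A : G) : Subgroup G :=
  Subgroup.closure (conj s k A '' {i | i ≤ k})

theorem conj_mem {i : ℕ} (hi : i ≤ k) : conj s k A i ∈ conjSubgroup s k A :=
  Subgroup.subset_closure ⟨i, hi, rfl⟩

/-- Conjugation by `s j` affects only the conjugates of index `j` and `j + 1`. One direction is the
recursion `conj_eq`; the other is the four-term relation solved for the missing conjugate. -/
theorem conj_conj_mem (h : IsTypeB s k A) {i j : ℕ} (hi : i ≤ k) (hj : j < k) :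
    s j * conj s k A i * (s j)⁻¹ ∈ conjSubgroup s k A ∧
      (s j)⁻¹ * conj s k A i * s j ∈ conjSubgroup s k A := by
  have hcomm : Commute (s j) (conj s k A i) → s j * conj s k A i * (s j)⁻¹ ∈ conjSubgroup s k A ∧
      (s j)⁻¹ * conj s k A i * s j ∈ conjSubgroup s k A := fun hc => by
    rw [hc.eq, mul_inv_cancel_right, mul_assoc, ← hc.eq, inv_mul_cancel_left]
    exact ⟨conj_mem hi, conj_mem hi⟩
  have e := conj_eq s A hj
  have e' : conj s k A (j + 1) = s j * conj s k A j * (s j)⁻¹ := by rw [e]; group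
  have h4 := conj_four h hj
  have m0 := conj_mem (s := s) (A := A) hj.le
  have m1 := conj_mem (s := s) (A := A) (Nat.succ_le_of_lt hj)
  rcases lt_trichotomy (j + 1) i with hlt | rfl | hlt
  · exact hcomm (commute_conj_of_lt h hi hlt)
  · refine ⟨?_, e ▸ m0⟩
    have : s j * conj s k A (j + 1) * (s j)⁻¹ =
        (conj s k A (j + 1))⁻¹ * conj s k A j * conj s k A (j + 1) := by
      rw [e]
      generalize conj s k A (j + 1) = a at *
      generalize s j = t at *
      rw [show a⁻¹ * (t⁻¹ * a * t) * a = a⁻¹ * t⁻¹ * (a * t * a) by group, eq_mul_inv_of_mul_eq h4]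
      group
    rw [this]
    exact mul_mem (mul_mem (inv_mem m1) m0) m1
  · rcases (Nat.lt_succ_iff.mp hlt).lt_or_eq with hlt | rfl
    · exact hcomm (commute_conj_of_gt h hlt hj)
    · refine ⟨e' ▸ m1, ?_⟩
      have : (s i)⁻¹ * conj s k A i * s i =
          conj s k A i * conj s k A (i + 1) * (conj s k A i)⁻¹ := by
        rw [e]
        generalize conj s k A (i + 1) = a at *
        generalize s i = t at *
        have h5 : a * t * a = t⁻¹ * (a * t * a * t) := by rw [h4]; group
        rw [show t⁻¹ * a * t * a * (t⁻¹ * a * t)⁻¹ = t⁻¹ * (a * t * a) * t⁻¹ * a⁻¹ * t by group, h5]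
        group
      rw [this]
      exact mul_mem (mul_mem m0 m1) (inv_mem m0)

theorem closure_le_normalizer (h : IsTypeB s k A) :
    Subgroup.closure (s '' {j | j < k}) ≤ Subgroup.normalizer (conjSubgroup s k A : Set G) := by
  rw [Subgroup.closure_le]
  rintro _ ⟨j, hj, rfl⟩
  have h1 : conjSubgroup s k A ≤ (conjSubgroup s k A).comap (MulAut.conj (s j)).toMonoidHom := by
    refine (Subgroup.closure_le _).mpr ?_
    rintro _ ⟨i, hi, rfl⟩
    exact (conj_conj_mem h hi hj).1
  -- The inverse is needed too: a conjugation may send an infinite subgroup properly into itself.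
  have h2 : conjSubgroup s k A ≤
      (conjSubgroup s k A).comap (MulAut.conj (s j)⁻¹).toMonoidHom := by
    refine (Subgroup.closure_le _).mpr ?_
    rintro _ ⟨i, hi, rfl⟩
    simpa using (conj_conj_mem h hi hj).2
  rw [SetLike.mem_coe, Subgroup.mem_normalizer_iff]
  refine fun g => ⟨fun hg => h1 hg, fun hg => ?_⟩
  have := h2 hg
  simpa [mul_assoc] using this

theorem exists_mul_of_mem_sup (h : IsTypeB s k A) {g : G}
    (hg : g ∈ conjSubgroup s k A ⊔ Subgroup.closure (s '' {j | j < k})) :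
    ∃ u ∈ conjSubgroup s k A, ∃ γ ∈ Subgroup.closure (s '' {j | j < k}), g = u * γ := by
  rw [← SetLike.mem_coe,
    Subgroup.coe_mul_of_right_le_normalizer_left _ _ (closure_le_normalizer h)] at hg
  obtain ⟨u, hu, γ, hγ, rfl⟩ := hg
  exact ⟨u, hu, γ, hγ, rfl⟩

theorem isBraidSeq_mono {l : ℕ} (h : IsBraidSeq s k) (hl : l ≤ k) : IsBraidSeq s l :=
  ⟨fun i hi => h.braid i (by omega), fun i j hij hj => h.comm i j hij (by omega)⟩

/-- Both sides equal the full twist `(s * t * s) ^ 2` on three strands. -/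
theorem four_sq {s t : G} (hb : s * t * s = t * s * t) :
    t ^ 2 * s * t ^ 2 * s = s * t ^ 2 * s * t ^ 2 := by
  have h1 : t * (t * s * t) = (t * s * t) * s := by
    rw [← hb, ← mul_assoc, ← mul_assoc, hb]
  calc t ^ 2 * s * t ^ 2 * s = t * (t * s * t) * t * s := by simp only [sq, mul_assoc]
    _ = (t * s * t) * (s * t * s) := by rw [h1]; simp only [mul_assoc]
    _ = (s * t * s) * (t * s * t) := by rw [hb]
    _ = s * t * (s * t * s) * t := by simp only [mul_assoc]
    _ = _ := by rw [hb]; simp only [sq, mul_assoc]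

theorem isTypeB_sq (h : IsBraidSeq s (k + 1)) : IsTypeB s k (s k ^ 2) where
  toIsBraidSeq := isBraidSeq_mono h (by omega)
  comm_last j hj := (h.comm j k hj (by omega)).pow_right 2
  four j hj := by
    subst hj
    exact four_sq (h.braid j (by omega))

theorem conj_sq_mul_desc (h : IsBraidSeq s (k + 1)) {i : ℕ} (hi : i ≤ k) :
    conj s k (s k ^ 2) i * desc s (k + 1) (i + 1) = desc s (k + 1) (i + 1) * s i ^ 2 := by
  induction hi using Nat.decreasingInduction with
  | self => simp [conj_self, desc_self]
  | of_succ i hi ih =>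
    rw [conj_eq s _ hi, desc_eq_mul s (by omega : i + 1 < k + 1)]
    have h1 := (commute_desc h (i := i + 1 + 1) (j := i) (by omega) (by omega))
    have hb := h.braid i (by omega)
    generalize desc s (k + 1) (i + 1 + 1) = d at *
    generalize conj s k (s k ^ 2) (i + 1) = a at *
    generalize s (i + 1) = t at *
    generalize s i = s at *
    have h2 : t * t * s * t = s * t * s * s := by
      calc t * t * s * t = t * (t * s * t) := by simp only [mul_assoc]
        _ = t * (s * t * s) := by rw [hb]
        _ = t * s * t * s := by simp only [mul_assoc]
        _ = _ := by rw [← hb]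
    calc s⁻¹ * a * s * (d * t) = s⁻¹ * a * (s * d) * t := by simp only [mul_assoc]
      _ = s⁻¹ * (a * d) * s * t := by rw [h1.eq]; simp only [mul_assoc]
      _ = (s⁻¹ * d) * (t * t * s * t) := by rw [ih]; simp only [sq, mul_assoc]
      _ = _ := by rw [h1.inv_left.eq, h2]; simp [sq, mul_assoc]

/-- The descending products act as representatives for the cosets of the braids that fix the
endpoint of the last strand. It suffices that right multiplication by each `s j` and its inverse
permutes the sets `D * desc s (k + 1) i`. -/
theorem exists_mul_desc_of_mem (h : IsBraidSeq s (k + 1)) {g : G}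
    (hg : g ∈ Subgroup.closure (s '' {j | j < k + 1})) :
    ∃ d ∈ conjSubgroup s k (s k ^ 2) ⊔ Subgroup.closure (s '' {j | j < k}), ∃ i ≤ k + 1,
      g = d * desc s (k + 1) i := by
  set D := conjSubgroup s k (s k ^ 2) ⊔ Subgroup.closure (s '' {j | j < k}) with hD
  have mS : ∀ j < k, s j ∈ D := fun j hj =>
    Subgroup.mem_sup_right (Subgroup.subset_closure ⟨j, hj, rfl⟩)
  have mU : ∀ i ≤ k, conj s k (s k ^ 2) i ∈ D := fun i hi => Subgroup.mem_sup_left (conj_mem hi)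
  -- The letter `s j` commutes past if `j + 1 < i`, lengthens the product if `j + 1 = i`, shortens
  -- it up to a square if `j = i`, and becomes `s (j - 1)` on the left if `j > i`. Squares are
  -- absorbed by `conj_sq_mul_desc`.
  have key : ∀ i ≤ k + 1, ∀ j < k + 1,
      (∃ d ∈ D, ∃ i' ≤ k + 1, desc s (k + 1) i * s j = d * desc s (k + 1) i') ∧
      (∃ d ∈ D, ∃ i' ≤ k + 1, desc s (k + 1) i * (s j)⁻¹ = d * desc s (k + 1) i') := by
    intro i hi j hj
    rcases lt_trichotomy (j + 1) i with hlt | rfl | hlt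
    · have hc := commute_desc h hi hlt
      exact ⟨⟨_, mS j (by omega), i, hi, hc.eq.symm⟩,
        ⟨_, inv_mem (mS j (by omega)), i, hi, hc.inv_left.eq.symm⟩⟩
    · refine ⟨⟨1, one_mem _, j, by omega, by rw [desc_eq_mul s hj, one_mul]⟩,
        ⟨_, inv_mem (mU j (by omega)), j, by omega, ?_⟩⟩
      rw [eq_inv_mul_iff_mul_eq, ← mul_assoc, conj_sq_mul_desc h (by omega), desc_eq_mul s hj]
      simp [sq, mul_assoc]
    · rcases (Nat.lt_succ_iff.mp hlt).lt_or_eq with hlt | rfl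
      · obtain ⟨j, rfl⟩ : ∃ l, j = l + 1 := ⟨j - 1, by omega⟩
        have hc := desc_mul_succ h (Nat.lt_succ_iff.mp hlt) hj
        refine ⟨⟨_, mS j (by omega), i, hi, hc⟩, ⟨_, inv_mem (mS j (by omega)), i, hi, ?_⟩⟩
        rw [mul_inv_eq_iff_eq_mul, mul_assoc, hc, inv_mul_cancel_left]
      · refine ⟨⟨_, mU i (by omega), i + 1, by omega, ?_⟩,
          ⟨1, one_mem _, i + 1, by omega, by rw [desc_eq_mul s hj]; simp⟩⟩
        rw [conj_sq_mul_desc h (by omega), desc_eq_mul s hj]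
        simp [sq, mul_assoc]
  induction hg using Subgroup.closure_induction_right with
  | one => exact ⟨1, one_mem _, k + 1, le_rfl, by simp [desc_self]⟩
  | mul_right g _ y hy ih =>
    obtain ⟨d, hd, i, hi, rfl⟩ := ih
    obtain ⟨j, hj, rfl⟩ := hy
    obtain ⟨d', hd', i', hi', e⟩ := (key i hi j hj).1
    exact ⟨d * d', mul_mem hd hd', i', hi', by rw [mul_assoc, e, mul_assoc]⟩
  | mul_inv_cancel g _ y hy ih =>
    obtain ⟨d, hd, i, hi, rfl⟩ := ih
    obtain ⟨j, hj, rfl⟩ := hy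
    obtain ⟨d', hd', i', hi', e⟩ := (key i hi j hj).2
    exact ⟨d * d', mul_mem hd hd', i', hi', by rw [mul_assoc, e, mul_assoc]⟩

end BraidSeq

/-! ### Centralizer of a free generator -/

namespace FreeGroup

variable {ι : Type*}

/-- A final letter `(of i)^±1` can be stripped, which shortens the word. With any other final
letter, `w * of i` is already reduced, so it equals the word of `of i * w` letter by letter, and the
last letters disagree. -/
theorem mem_zpowers_of_commute_of (i : ι) (w : FreeGroup ι) (h : Commute w (of i)) :
    w ∈ Subgroup.zpowers (of i) := by
  classical
  induction hl : w.norm using Nat.strong_induction_on generalizing w with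
  | _ l ih =>
  subst hl
  rcases List.eq_nil_or_concat w.toWord with h0 | ⟨L, ⟨j, b⟩, hL⟩
  · rw [toWord_eq_nil_iff.mp h0]
    exact one_mem _
  have hw : w = mk L * mk [(j, b)] := by rw [mul_mk, ← List.concat_eq_append, ← hL, mk_toWord]
  have hlen : w.norm = L.length + 1 := by simp [norm, hL]
  by_cases hji : j = i
  · subst hji
    have hm : mk [(j, b)] ∈ Subgroup.zpowers (of j) := by
      cases b
      · exact inv_mem (Subgroup.mem_zpowers (of j))
      · exact Subgroup.mem_zpowers (of j)
    have hc : Commute (mk [(j, b)]) (of j) := by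
      obtain ⟨n, hn⟩ := hm
      rw [← hn]
      exact (Commute.refl _).zpow_left n
    rw [hw]
    refine mul_mem (ih _ ?_ (mk L) ?_ rfl) hm
    · rw [hlen]
      exact Nat.lt_succ_of_le norm_mk_le
    · have : mk L = w * (mk [(j, b)])⁻¹ := by rw [hw]; group
      rw [this]
      exact h.mul_left hc.inv_left
  · exfalso
    have hred : IsReduced (w.toWord ++ [(i, true)]) := by
      have h1 := isReduced_toWord (x := w)
      rw [hL, List.concat_eq_append] at h1 ⊢
      exact h1.append_overlap (L₃ := [(i, true)]) (by simp [hji]) (by simp)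
    have e1 : (w * of i).toWord = w.toWord ++ [(i, true)] := by
      rw [toWord_mul, toWord_of, hred.reduce_eq]
    have e2 : List.Sublist (w.toWord ++ [(i, true)]) ((i, true) :: w.toWord) := by
      rw [← e1, h.eq]
      simpa using toWord_mul_sublist (of i) w
    have e3 := e2.eq_of_length (by simp)
    have e4 := congrArg List.getLast? e3
    rw [hL] at e4
    simp [List.getLast?_cons] at e4
    exact hji e4.1.symm

end FreeGroup

/-! ### The action on the free group and Artin's theorem -/

namespace CircularBraidGroup

open Fn BraidSeq

variable {n : ℕ}

/-- The right action of `CB_n` on the free group. -/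
def act (g : CircularBraidGroup n) : MulAut (Fn n) := (rhoCB n g).unop

theorem act_mul (g h : CircularBraidGroup n) (w : Fn n) : act (g * h) w = act h (act g w) := by
  simp [act]

theorem act_one (w : Fn n) : act (1 : CircularBraidGroup n) w = w := by simp [act]

theorem act_inv_act (g : CircularBraidGroup n) (w : Fn n) : act g⁻¹ (act g w) = w := by
  rw [← act_mul, mul_inv_cancel, act_one]

theorem act_act_inv (g : CircularBraidGroup n) (w : Fn n) : act g (act g⁻¹ w) = w := by
  rw [← act_mul, inv_mul_cancel, act_one]

theorem zeta_conj_sigma (i : ZMod n) : (zeta n)⁻¹ * sigma i * zeta n = sigma (i + 1) :=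
  mul_inv_eq_one.mp (PresentedGroup.one_of_mem (CBRel.shift i))

/-- The generators `σ i` as a sequence indexed by the natural numbers. -/
def sig (n : ℕ) (i : ℕ) : CircularBraidGroup n := sigma (i : ZMod n)

/-- The free generators as a sequence indexed by the natural numbers. -/
def gen (n : ℕ) (i : ℕ) : Fn n := x (i : ZMod n)

theorem natCast_inj {i j : ℕ} (hi : i < n) (hj : j < n) : (i : ZMod n) = j ↔ i = j := by
  rw [ZMod.natCast_eq_natCast_iff', Nat.mod_eq_of_lt hi, Nat.mod_eq_of_lt hj]

/-- The length `n - 1` leaves out the generator that joins the last index to the first: no adjacency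
wraps around, and a braid relation is asked for only when `3 ≤ n`. -/
theorem isBraidSeq_sig (n : ℕ) : IsBraidSeq (sig n) (n - 1) where
  braid i hi := by
    have (a : ZMod n) :
        sigma a * sigma (a + 1) * sigma a = sigma (a + 1) * sigma a * sigma (a + 1) :=
      mul_inv_eq_one.mp (PresentedGroup.one_of_mem (CBRel.braid (by omega) a))
    simpa [sig] using this i
  comm i j hij hj := by
    have h1 : (j : ZMod n) ≠ i + 1 := by
      rw [← Nat.cast_succ, Ne, natCast_inj (by omega) (by omega)]
      omega
    have h2 : (i : ZMod n) ≠ j + 1 := by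
      rw [← Nat.cast_succ, Ne, natCast_inj (by omega) (by omega)]
      omega
    exact mul_inv_eq_one.mp (PresentedGroup.one_of_mem (CBRel.comm _ _ h1 h2))

theorem zeta_conj_sig (i : ℕ) : (zeta n)⁻¹ * sig n i * zeta n = sig n (i + 1) := by
  simpa [sig] using zeta_conj_sigma (i : ZMod n)

theorem act_sig (i j : ℕ) : act (sig n i) (gen n j) =
    if (j : ZMod n) = i then gen n i * gen n (i + 1) * (gen n i)⁻¹
    else if (j : ZMod n) = (i + 1 : ℕ) then gen n i else gen n j := by
  simp [act, sig, rhoCB_sigma, gen, artinAut_x]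

theorem act_sig_self (i : ℕ) :
    act (sig n i) (gen n i) = gen n i * gen n (i + 1) * (gen n i)⁻¹ := by
  rw [act_sig, if_pos rfl]

theorem act_sig_succ {i : ℕ} (hi : i + 1 < n) : act (sig n i) (gen n (i + 1)) = gen n i := by
  rw [act_sig, if_neg, if_pos rfl]
  rw [natCast_inj hi (by omega)]
  omega

theorem act_sig_of_ne {i j : ℕ} (hi : i + 1 < n) (hj : j < n) (h1 : j ≠ i) (h2 : j ≠ i + 1) :
    act (sig n i) (gen n j) = gen n j := by
  rw [act_sig, if_neg, if_neg]
  · rwa [natCast_inj hj hi]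
  · rwa [natCast_inj hj (by omega)]

theorem act_zeta (i : ℕ) : act (zeta n) (gen n i) = gen n (i + 1) := by
  simp [act, rhoCB_zeta, gen, shiftAut_x]

theorem hom_ext_gen (hn : n ≠ 0) {M : Type*} [Group M] {f g : Fn n →* M}
    (h : ∀ i < n, f (gen n i) = g (gen n i)) : f = g := by
  have : NeZero n := ⟨hn⟩
  refine FreeGroup.ext_hom f g fun j => ?_
  have := h j.val j.val_lt
  rwa [gen, ZMod.natCast_zmod_val] at this

/-- The endomorphism of the free group which sends the generator `i` to `1`. -/
def kill (n : ℕ) (i : ℕ) : Fn n →* Fn n :=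
  FreeGroup.lift fun j => if j = (i : ZMod n) then 1 else x j

theorem kill_self (i : ℕ) : kill n i (gen n i) = 1 := by
  simp [kill, gen, x]

theorem kill_of_ne {i j : ℕ} (hi : i < n) (hj : j < n) (h : j ≠ i) :
    kill n i (gen n j) = gen n j := by
  have : (j : ZMod n) ≠ i := by rwa [Ne, natCast_inj hj hi]
  simp [kill, gen, x, this]

theorem gen_ne_one (i : ℕ) : gen n i ≠ 1 := FreeGroup.of_ne_one _

theorem act_of_mem_closure {k : ℕ} {γ : CircularBraidGroup n}
    (hγ : γ ∈ Subgroup.closure (sig n '' {j | j < k})) {j : ℕ} (hj : k < j) (hjn : j < n) :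
    act γ (gen n j) = gen n j := by
  induction hγ using Subgroup.closure_induction with
  | mem y hy =>
    obtain ⟨i, hi, rfl⟩ := hy
    simp only [Set.mem_ofPred_eq] at hi
    exact act_sig_of_ne (by omega) hjn (by omega) (by omega)
  | one => exact act_one _
  | mul g h _ _ hg hh => rw [act_mul, hg, hh]
  | inv g _ hg => simpa only [hg] using act_inv_act g (gen n j)

theorem kill_act_of_mem_closure {k : ℕ} {γ : CircularBraidGroup n}
    (hγ : γ ∈ Subgroup.closure (sig n '' {j | j < k})) {m : ℕ} (hm : k < m) (hmn : m < n)
    (w : Fn n) : kill n m (act γ w) = act γ (kill n m w) := by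
  induction hγ using Subgroup.closure_induction generalizing w with
  | mem y hy =>
    obtain ⟨i, hi, rfl⟩ := hy
    simp only [Set.mem_ofPred_eq] at hi
    have : (kill n m).comp (act (sig n i)).toMonoidHom =
        (act (sig n i)).toMonoidHom.comp (kill n m) := by
      refine hom_ext_gen (by omega) fun j hj => ?_
      show kill n m (act (sig n i) (gen n j)) = act (sig n i) (kill n m (gen n j))
      by_cases h1 : j = i
      · subst h1
        rw [kill_of_ne hmn hj (by omega), act_sig_self]
        simp [kill_of_ne hmn hj (by omega : j ≠ m),
          kill_of_ne hmn (by omega : j + 1 < n) (by omega)]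
      by_cases h2 : j = i + 1
      · subst h2
        rw [kill_of_ne hmn hj (by omega), act_sig_succ (by omega), kill_of_ne hmn (by omega)
          (by omega)]
      rw [act_sig_of_ne (by omega) hj h1 h2]
      by_cases h3 : j = m
      · subst h3
        rw [kill_self, map_one]
      · rw [kill_of_ne hmn hj h3, act_sig_of_ne (by omega) hj h1 h2]
    exact DFunLike.congr_fun this w
  | one => simp only [act_one]
  | mul g h _ _ hg hh => rw [act_mul, hh, hg, act_mul]
  | inv g _ hg => rw [← act_inv_act g (kill n m (act g⁻¹ w)), ← hg, act_act_inv]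

theorem act_desc {k i : ℕ} (hk : k < n) (hi : i ≤ k) :
    act (desc (sig n) k i) (gen n k) = gen n i := by
  induction hi using Nat.decreasingInduction with
  | self => rw [desc_self, act_one]
  | of_succ i hi ih => rw [desc_eq_mul _ hi, act_mul, ih, act_sig_succ (by omega)]

/-- The homomorphism which sends the free generators to the conjugates of `A`. -/
def conjHom (n k : ℕ) (A : CircularBraidGroup n) : Fn n →* CircularBraidGroup n :=
  FreeGroup.lift fun j => conj (sig n) k A j.val

theorem conjHom_gen {k i : ℕ} {A : CircularBraidGroup n} (hi : i < n) :
    conjHom n k A (gen n i) = conj (sig n) k A i := by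
  have : NeZero n := ⟨by omega⟩
  simp [conjHom, gen, x, ZMod.val_cast_of_lt hi]

theorem act_conj_sq {k i : ℕ} (hk : k + 1 < n) (hi : i ≤ k) :
    (∀ w, kill n (k + 1) (act (conj (sig n) k (sig n k ^ 2) i) w) = kill n (k + 1) w) ∧
    ∃ v, act (conj (sig n) k (sig n k ^ 2) i) (gen n (k + 1)) = v * gen n (k + 1) * v⁻¹ ∧
      kill n (k + 1) v = gen n i := by
  induction hi using Nat.decreasingInduction with
  | self =>
    rw [conj_self]
    have hs : act (sig n k ^ 2) (gen n (k + 1)) = gen n k * gen n (k + 1) * (gen n k)⁻¹ := by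
      rw [sq, act_mul, act_sig_succ hk, act_sig_self]
    refine ⟨fun w => ?_, gen n k, hs, kill_of_ne hk (by omega) (by omega)⟩
    have : (kill n (k + 1)).comp (act (sig n k ^ 2)).toMonoidHom = kill n (k + 1) := by
      refine hom_ext_gen (by omega) fun j hj => ?_
      show kill n (k + 1) (act (sig n k ^ 2) (gen n j)) = _
      by_cases h1 : j = k + 1
      · subst h1
        simp [hs, kill_self]
      rw [sq, act_mul]
      by_cases h2 : j = k
      · subst h2
        rw [act_sig_self]
        simp [act_sig_self, act_sig_succ hk, kill_self]
      rw [act_sig_of_ne hk hj h2 h1, act_sig_of_ne hk hj h2 h1]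
    exact DFunLike.congr_fun this w
  | of_succ i hi ih =>
    obtain ⟨h1, v, hv, hkv⟩ := ih
    have hs : sig n i ∈ Subgroup.closure (sig n '' {j | j < k}) :=
      Subgroup.subset_closure ⟨i, hi, rfl⟩
    rw [conj_eq _ _ hi]
    refine ⟨fun w => ?_, act (sig n i) v, ?_, ?_⟩
    · rw [act_mul, act_mul, kill_act_of_mem_closure hs (by omega) hk, h1,
        ← kill_act_of_mem_closure hs (by omega) hk, act_act_inv]
    · rw [act_mul, act_mul, act_of_mem_closure (inv_mem hs) (by omega) hk, hv]
      simp [act_of_mem_closure hs (by omega : k < k + 1) hk]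
    · rw [kill_act_of_mem_closure hs (by omega) hk, hkv, act_sig_succ (by omega)]

/-- This recovers `u` from its action. The word `v` is determined only up to right powers of the
last generator, which `kill` discards; `v ↦ kill v` is multiplicative because `u` acts trivially
modulo that generator. Freeness of the subgroup is not required. -/
theorem act_conjSubgroup_sq {k : ℕ} (hk : k + 1 < n) {u : CircularBraidGroup n}
    (hu : u ∈ conjSubgroup (sig n) k (sig n k ^ 2)) :
    (∀ w, kill n (k + 1) (act u w) = kill n (k + 1) w) ∧
    ∃ v, act u (gen n (k + 1)) = v * gen n (k + 1) * v⁻¹ ∧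
      u = conjHom n k (sig n k ^ 2) (kill n (k + 1) v) := by
  induction hu using Subgroup.closure_induction with
  | mem y hy =>
    obtain ⟨i, hi, rfl⟩ := hy
    simp only [Set.mem_ofPred_eq] at hi
    obtain ⟨h1, v, hv, hkv⟩ := act_conj_sq hk hi
    exact ⟨h1, v, hv, by rw [hkv, conjHom_gen (by omega)]⟩
  | one => exact ⟨fun w => by rw [act_one], 1, by simp [act_one], by simp⟩
  | mul g h _ _ hg hh =>
    obtain ⟨h1, v, hv, hkv⟩ := hg
    obtain ⟨h1', v', hv', hkv'⟩ := hh
    refine ⟨fun w => by rw [act_mul, h1', h1], act h v * v', ?_, ?_⟩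
    · rw [act_mul, hv]
      simp [hv', mul_assoc]
    · rw [map_mul, h1', map_mul, ← hkv, ← hkv']
  | inv g _ hg =>
    obtain ⟨h1, v, hv, hkv⟩ := hg
    have h2 : ∀ w, kill n (k + 1) (act g⁻¹ w) = kill n (k + 1) w := fun w => by
      rw [← h1, act_act_inv]
    refine ⟨h2, (act g⁻¹ v)⁻¹, ?_, ?_⟩
    · have := congrArg (act g⁻¹) hv
      rw [act_inv_act] at this
      simp only [map_mul, map_inv] at this
      nth_rw 2 [this]
      group
    · rw [map_inv, h2, map_inv, ← hkv]

/-- The Artin representation of the braid group is faithful. -/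
theorem eq_one_of_act_eq_one {k : ℕ} (hk : k < n) {g : CircularBraidGroup n}
    (hg : g ∈ Subgroup.closure (sig n '' {j | j < k})) (h : ∀ w, act g w = w) : g = 1 := by
  induction k generalizing g with
  | zero => simpa using hg
  | succ k ih =>
    have hb : IsBraidSeq (sig n) (k + 1) := isBraidSeq_mono (isBraidSeq_sig n) (by omega)
    obtain ⟨d, hd, i, hi, rfl⟩ := exists_mul_desc_of_mem hb hg
    obtain ⟨u, hu, γ, hγ, rfl⟩ := exists_mul_of_mem_sup (isTypeB_sq hb) hd
    obtain ⟨hu1, v, hv, huv⟩ := act_conjSubgroup_sq hk hu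
    have hγm := act_of_mem_closure hγ (Nat.lt_succ_self k) hk
    -- Otherwise the last generator would be sent to a conjugate of `gen n i`, which dies under
    -- `kill n i`.
    obtain rfl : i = k + 1 := by
      by_contra hne
      have h1 := congrArg (kill n i) (h (gen n (k + 1)))
      rw [act_mul, act_mul, hv, kill_of_ne (by omega) hk (Ne.symm hne)] at h1
      simp only [map_mul, map_inv, hγm, act_desc hk hi, kill_self, mul_one, mul_inv_cancel] at h1
      exact gen_ne_one _ h1.symm
    simp only [desc_self, mul_one] at h
    -- Modulo the last generator `u` disappears, so `γ` alone acts trivially and induction applies.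
    have hγ1 : γ = 1 := by
      refine ih (by omega) hγ fun w => ?_
      have : (act γ).toMonoidHom = MonoidHom.id _ := by
        refine hom_ext_gen (by omega) fun j hj => ?_
        show act γ (gen n j) = gen n j
        by_cases hjk : j = k + 1
        · rw [hjk, hγm]
        have h1 := congrArg (kill n (k + 1)) (h (gen n j))
        rwa [act_mul, kill_act_of_mem_closure hγ (Nat.lt_succ_self k) hk, hu1,
          kill_of_ne hk hj hjk] at h1
      exact DFunLike.congr_fun this w
    subst hγ1
    -- Now `v` commutes with the last generator, so it is a power of it; hence `kill v = 1` and `u =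
    -- 1`.
    have h1 := h (gen n (k + 1))
    rw [act_mul, act_one, hv, mul_inv_eq_iff_eq_mul] at h1
    obtain ⟨l, rfl⟩ := FreeGroup.mem_zpowers_of_commute_of _ v h1
    have : kill n (k + 1) (FreeGroup.of ((k + 1 : ℕ) : ZMod n)) = 1 := kill_self (k + 1)
    simp only [map_zpow, this, one_zpow, map_one] at huv
    simp [huv, desc_self]

end CircularBraidGroup

/-! ### The factorization of `CB_n` into inner automorphisms and braids -/

namespace CircularBraidGroup

open Fn BraidSeq

variable {n : ℕ}

theorem zeta_conj_desc {k i : ℕ} (hi : i ≤ k) :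
    (zeta n)⁻¹ * desc (sig n) k i * zeta n = desc (sig n) (k + 1) (i + 1) := by
  induction hi using Nat.decreasingInduction with
  | self => simp [desc_self]
  | of_succ i hi ih =>
    rw [desc_eq_mul _ hi, desc_eq_mul _ (by omega : i + 1 < k + 1), ← ih, ← zeta_conj_sig i]
    group

theorem desc_mul_desc_one {k l : ℕ} (hk : k ≤ n - 1) (hl : l + 1 ≤ k) :
    desc (sig n) k 0 * desc (sig n) (l + 1) 1 = desc (sig n) l 0 * desc (sig n) k 0 := by
  induction l with
  | zero => simp [desc_self]
  | succ l ih =>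
    rw [desc_succ _ (by omega : 1 ≤ l + 1), desc_succ _ (Nat.zero_le l), ← mul_assoc,
      desc_mul_succ (isBraidSeq_mono (isBraidSeq_sig n) hk) (Nat.zero_le l) (by omega), mul_assoc,
      ih (by omega), mul_assoc]

/-- The element of `CB_n` which acts on the free group by conjugation by the last generator. -/
def lastInner (n : ℕ) : CircularBraidGroup n := zeta n * (desc (sig n) (n - 1) 0)⁻¹

/-- Both `zeta n` and the full descending product conjugate `s j` to `s (j + 1)`, so their quotient
`A` commutes with `s j`. For the last `s`, the four-term relation says that `(A * s) ^ 2` commutes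
with `s`. -/
theorem isTypeB_lastInner (n : ℕ) : IsTypeB (sig n) (n - 1) (lastInner n) where
  toIsBraidSeq := isBraidSeq_sig n
  comm_last j hj := by
    have h1 := desc_mul_succ (isBraidSeq_sig n) (Nat.zero_le j) hj
    rw [← zeta_conj_sig] at h1
    unfold lastInner
    generalize desc (sig n) (n - 1) 0 = c at *
    show _ = _
    have h2 : sig n j = zeta n * c⁻¹ * sig n j * c * (zeta n)⁻¹ := by
      rw [mul_assoc (zeta n), mul_assoc (zeta n), mul_assoc c⁻¹, ← h1]
      group
    nth_rw 1 [h2]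
    group
  four j hj := by
    have hc : desc (sig n) (n - 1) 0 = sig n j * desc (sig n) j 0 := by
      rw [← hj, desc_succ _ (Nat.zero_le j)]
    have he : desc (sig n) (n - 1) 0 = desc (sig n) (j + 1) 1 * sig n 0 := by
      rw [← hj, desc_eq_mul _ (Nat.succ_pos j)]
    have hz := zeta_conj_desc (n := n) (Nat.zero_le j)
    have hm := desc_mul_desc_one (n := n) le_rfl hj.le
    -- Periodicity enters here: two shifts carry index `n - 2` to `n`, which is `0`.
    have h0 : (zeta n)⁻¹ * ((zeta n)⁻¹ * sig n j * zeta n) * zeta n = sig n 0 := by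
      rw [zeta_conj_sig, zeta_conj_sig]
      simp [sig, show j + 1 + 1 = n by omega]
    unfold lastInner
    generalize desc (sig n) (n - 1) 0 = c at *
    generalize desc (sig n) j 0 = c' at *
    generalize desc (sig n) (j + 1) 1 = e at *
    generalize sig n j = s at *
    generalize sig n 0 = s₀ at *
    generalize zeta n = z at *
    subst hc
    have h1 : s * (c' * e) = c' * e * s₀ := by rw [mul_assoc c', ← he, ← hm, mul_assoc]
    have h2 : z * c'⁻¹ * (z * c'⁻¹) = z * z * (c' * e)⁻¹ := by
      rw [← hz]
      group
    have h3 : s * (z * c'⁻¹ * (z * c'⁻¹)) = z * c'⁻¹ * (z * c'⁻¹) * s := by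
      have h4 : (c' * e)⁻¹ * s = s₀ * (c' * e)⁻¹ := by
        rw [inv_mul_eq_iff_eq_mul, ← mul_assoc, ← h1, mul_inv_cancel_right]
      rw [h2, mul_assoc _ _ s, h4, ← h0]
      group
    calc z * (s * c')⁻¹ * s * (z * (s * c')⁻¹) * s = z * c'⁻¹ * (z * c'⁻¹) := by group
      _ = s * (z * c'⁻¹ * (z * c'⁻¹)) * s⁻¹ := by rw [h3]; group
      _ = _ := by group

theorem act_desc_of_lt {k i j : ℕ} (hk : k < n) (hi : i ≤ k) (hj : j < i) :
    act (desc (sig n) k i) (gen n j) = gen n j := by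
  induction hi using Nat.decreasingInduction with
  | self => rw [desc_self, act_one]
  | of_succ i hi ih =>
    rw [desc_eq_mul _ hi, act_mul, ih (by omega),
      act_sig_of_ne (by omega) (by omega) (by omega) (by omega)]

theorem act_desc_of_le {k i j : ℕ} (hk : k < n) (hi : i ≤ k) (hij : i ≤ j) (hj : j < k) :
    act (desc (sig n) k i) (gen n j) = gen n i * gen n (j + 1) * (gen n i)⁻¹ := by
  induction hi using Nat.decreasingInduction with
  | self => omega
  | of_succ i hi ih =>
    rw [desc_eq_mul _ hi, act_mul]
    rcases hij.lt_or_eq with hlt | rfl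
    · rw [ih hlt]
      simp [act_sig_succ (by omega : i + 1 < n), act_sig_of_ne (by omega : i + 1 < n)
        (by omega : j + 1 < n) (by omega) (by omega)]
    · rw [act_desc_of_lt hk hi (by omega), act_sig_self]

/-- The descending product sends `x_j` to `x_0 x_{j+1} x_0⁻¹` for `j < n - 1` and `x_{n-1}` to
`x_0`. It thus differs from the shift only by an inner automorphism. -/
theorem act_lastInner (hn : n ≠ 0) (w : Fn n) :
    act (lastInner n) w = (gen n (n - 1))⁻¹ * w * gen n (n - 1) := by
  have key : (act (zeta n)).toMonoidHom = ((act (desc (sig n) (n - 1) 0)).toMonoidHom.comp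
      (MulAut.conj (gen n (n - 1))⁻¹).toMonoidHom) := by
    refine hom_ext_gen hn fun j hj => ?_
    show act (zeta n) (gen n j) = act (desc (sig n) (n - 1) 0)
      ((gen n (n - 1))⁻¹ * gen n j * (gen n (n - 1))⁻¹⁻¹)
    have hl : act (desc (sig n) (n - 1) 0) (gen n (n - 1)) = gen n 0 :=
      act_desc (by omega) (Nat.zero_le _)
    rw [act_zeta]
    rcases (Nat.le_sub_one_of_lt hj).lt_or_eq with h | rfl
    · simp [hl, act_desc_of_le (by omega : n - 1 < n) (Nat.zero_le _) (Nat.zero_le j) h, mul_assoc]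
    · simp only [inv_inv, inv_mul_cancel, one_mul, hl]
      simp [gen, Nat.sub_add_cancel (Nat.pos_of_ne_zero hn)]
  have h1 : act (zeta n) w = act (desc (sig n) (n - 1) 0)
      ((gen n (n - 1))⁻¹ * w * (gen n (n - 1))⁻¹⁻¹) := DFunLike.congr_fun key w
  rw [lastInner, act_mul, h1, act_inv_act, inv_inv]

theorem act_conj_lastInner {i : ℕ} (hi : i < n) (w : Fn n) :
    act (conj (sig n) (n - 1) (lastInner n) i) w = (gen n i)⁻¹ * w * gen n i := by
  have hi' : i ≤ n - 1 := by omega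
  induction hi' using Nat.decreasingInduction generalizing w with
  | self => rw [conj_self, act_lastInner (by omega)]
  | of_succ i hi' ih =>
    rw [conj_eq _ _ hi', act_mul, act_mul, ih (by omega)]
    simp [act_sig_succ (by omega : i + 1 < n), act_act_inv]

theorem act_conjHom_lastInner (hn : n ≠ 0) (w y : Fn n) :
    act (conjHom n (n - 1) (lastInner n) w) y = w⁻¹ * y * w := by
  have : NeZero n := ⟨hn⟩
  induction w using FreeGroup.induction_on generalizing y with
  | C1 => simp [act_one]
  | of j =>
    have := act_conj_lastInner j.val_lt y
    rwa [← conjHom_gen j.val_lt, gen, ZMod.natCast_zmod_val] at this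
  | inv_of j ih =>
    have := act_inv_act (conjHom n (n - 1) (lastInner n) (FreeGroup.of j))
      (FreeGroup.of j * y * (FreeGroup.of j)⁻¹)
    rw [ih] at this
    rw [map_inv, inv_inv, ← this]
    group
  | mul v w hv hw =>
    rw [map_mul, act_mul, hv, hw]
    group

theorem conjSubgroup_le_range (hn : n ≠ 0) :
    conjSubgroup (sig n) (n - 1) (lastInner n) ≤ (conjHom n (n - 1) (lastInner n)).range := by
  refine (Subgroup.closure_le _).mpr ?_
  rintro _ ⟨i, hi, rfl⟩
  simp only [Set.mem_ofPred_eq] at hi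
  exact ⟨gen n i, conjHom_gen (by omega)⟩

theorem conjSubgroup_sup_closure (hn : 2 ≤ n) :
    conjSubgroup (sig n) (n - 1) (lastInner n) ⊔
      Subgroup.closure (sig n '' {j | j < n - 1}) = ⊤ := by
  set D := conjSubgroup (sig n) (n - 1) (lastInner n) ⊔
    Subgroup.closure (sig n '' {j | j < n - 1}) with hD
  have hs : ∀ i < n - 1, sig n i ∈ D := fun i hi =>
    Subgroup.mem_sup_right (Subgroup.subset_closure ⟨i, hi, rfl⟩)
  have hz : zeta n ∈ D := by
    have h1 : lastInner n ∈ D := by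
      have := conj_mem (s := sig n) (A := lastInner n) (le_refl (n - 1))
      rw [conj_self] at this
      exact Subgroup.mem_sup_left this
    have h2 : desc (sig n) (n - 1) 0 ∈ D := Subgroup.mem_sup_right (desc_mem_closure _ _ _)
    simpa [lastInner] using mul_mem h1 h2
  rw [eq_top_iff, ← PresentedGroup.closure_range_of, Subgroup.closure_le]
  rintro _ ⟨i | _, rfl⟩
  · have : NeZero n := ⟨by omega⟩
    have e : PresentedGroup.of (CBGen.sigma i) = sig n i.val := by
      rw [sig, ZMod.natCast_zmod_val]
      rfl
    rw [e]
    have hi := i.val_lt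
    by_cases h : i.val < n - 1
    · exact hs _ h
    -- The one generator outside `B` is a `ζ`-conjugate of `sig n (n - 2)`.
    · rw [show i.val = n - 2 + 1 by omega, ← zeta_conj_sig]
      exact mul_mem (mul_mem (inv_mem hz) (hs _ (by omega))) hz
  · exact hz

/-! ### The invariant product, winding numbers and the kernel -/

/-- The product of the first `m` free generators. -/
def genProd (n m : ℕ) : Fn n := ((List.range m).map (gen n)).prod

theorem genProd_succ (m : ℕ) : genProd n (m + 1) = genProd n m * gen n m := by
  simp [genProd, List.range_succ]

theorem map_genProd {M : Type*} [Group M] {f g : Fn n →* M} {m : ℕ}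
    (h : ∀ i < m, f (gen n i) = g (gen n i)) : f (genProd n m) = g (genProd n m) := by
  simp only [genProd, map_list_prod, List.map_map]
  congr 1
  exact List.map_congr_left fun i hi => h i (List.mem_range.mp hi)

theorem act_sig_genProd_of_le {i m : ℕ} (hi : i + 1 < n) (hm : m ≤ i) :
    act (sig n i) (genProd n m) = genProd n m :=
  map_genProd (f := (act (sig n i)).toMonoidHom) (g := MonoidHom.id _) fun j hj =>
    act_sig_of_ne hi (by omega) (by omega) (by omega)

theorem act_sig_genProd {i m : ℕ} (him : i + 2 ≤ m) (hm : m ≤ n) :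
    act (sig n i) (genProd n m) = genProd n m := by
  induction m, him using Nat.le_induction with
  | base =>
    rw [genProd_succ, genProd_succ, map_mul, map_mul, act_sig_genProd_of_le (by omega) le_rfl,
      act_sig_self, act_sig_succ (by omega)]
    group
  | succ m him ih =>
    rw [genProd_succ, map_mul, ih (by omega),
      act_sig_of_ne (by omega) (by omega) (by omega) (by omega)]

theorem act_genProd {γ : CircularBraidGroup n}
    (hγ : γ ∈ Subgroup.closure (sig n '' {j | j < n - 1})) :
    act γ (genProd n n) = genProd n n := by
  induction hγ using Subgroup.closure_induction with
  | mem y hy =>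
    obtain ⟨i, hi, rfl⟩ := hy
    simp only [Set.mem_ofPred_eq] at hi
    exact act_sig_genProd (by omega) le_rfl
  | one => exact act_one _
  | mul g h _ _ hg hh => rw [act_mul, hg, hh]
  | inv g _ hg => simpa only [hg] using act_inv_act g (genProd n n)

/-- The product can replace `gen n m` in the basis: `θ` turns it into `gen n m` and has left inverse
`θ'`, so the centralizer of a free generator gives the claim. -/
theorem mem_zpowers_genProd {m : ℕ} (hm : m < n) {w : Fn n}
    (h : Commute w (genProd n (m + 1))) : w ∈ Subgroup.zpowers (genProd n (m + 1)) := by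
  let f (v : Fn n) : Fn n →* Fn n := FreeGroup.lift fun j => if j = (m : ZMod n) then v else x j
  have f_self : ∀ v, f v (gen n m) = v := fun v => by simp [f, gen, x]
  have f_ne : ∀ v, ∀ j < n, j ≠ m → f v (gen n j) = gen n j := fun v j hj hjm => by
    have : (j : ZMod n) ≠ m := by rwa [Ne, natCast_inj hj hm]
    simp [f, gen, x, this]
  have f_prod : ∀ v, f v (genProd n m) = genProd n m := fun v =>
    map_genProd (g := MonoidHom.id _) fun j hj => f_ne v j (by omega) (by omega)
  let θ := f ((genProd n m)⁻¹ * gen n m)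
  let θ' := f (genProd n m * gen n m)
  have hθ : θ (genProd n (m + 1)) = gen n m := by
    rw [genProd_succ, map_mul, f_prod, f_self, mul_inv_cancel_left]
  have hθ' : θ' (gen n m) = genProd n (m + 1) := by rw [genProd_succ, f_self]
  have hinv : θ'.comp θ = MonoidHom.id _ := by
    refine hom_ext_gen (by omega) fun j hj => ?_
    show θ' (θ (gen n j)) = gen n j
    by_cases hjm : j = m
    · subst hjm
      simp [θ, θ', f_self, f_prod]
    · simp [θ, θ', f_ne _ j hj hjm]
  have h1 : Commute (θ w) (gen n m) := hθ ▸ h.map θ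
  obtain ⟨l, hl⟩ := FreeGroup.mem_zpowers_of_commute_of _ _ h1
  refine ⟨l, ?_⟩
  have h2 : θ' (θ w) = w := DFunLike.congr_fun hinv w
  have h3 : gen n m ^ l = θ w := hl
  simp only
  rw [← h2, ← h3, map_zpow, hθ']

/-- The winding number: the homomorphism to `ℤ` which sends each `σ i` to `0` and `ζ` to `1`. -/
def winding (n : ℕ) : CircularBraidGroup n →* Multiplicative ℤ :=
  PresentedGroup.toGroup
    (f := fun g => match g with
      | .sigma _ => 1
      | .zeta => Multiplicative.ofAdd 1)
    (by
      rintro _ (_ | _ | _) <;> simp [CBGen.s, CBGen.z])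

theorem winding_sig (i : ℕ) : winding n (sig n i) = 1 := PresentedGroup.toGroup.of _

theorem winding_zeta : winding n (zeta n) = Multiplicative.ofAdd 1 := PresentedGroup.toGroup.of _

theorem winding_of_mem_closure {k : ℕ} {γ : CircularBraidGroup n}
    (hγ : γ ∈ Subgroup.closure (sig n '' {j | j < k})) : winding n γ = 1 := by
  have : Subgroup.closure (sig n '' {j | j < k}) ≤ (winding n).ker := by
    refine (Subgroup.closure_le _).mpr ?_
    rintro _ ⟨i, _, rfl⟩
    exact winding_sig i
  exact this hγ

theorem winding_conjHom_gen {i : ℕ} (hi : i < n) :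
    winding n (conjHom n (n - 1) (lastInner n) (gen n i)) = Multiplicative.ofAdd 1 := by
  rw [conjHom_gen hi]
  simp [conj, lastInner, winding_of_mem_closure (desc_mem_closure _ _ _), winding_zeta]

theorem winding_conjHom_genProd {m : ℕ} (hm : m ≤ n) :
    winding n (conjHom n (n - 1) (lastInner n) (genProd n m)) =
      Multiplicative.ofAdd (m : ℤ) := by
  induction m with
  | zero => simp [genProd]
  | succ m ih =>
    rw [genProd_succ, map_mul, map_mul, ih (by omega), winding_conjHom_gen hm, ← ofAdd_add]
    simp

theorem exists_eq_mul_of_act_eq (hn : 2 ≤ n) {g : CircularBraidGroup n} (hg : ∀ w, act g w = w) :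
    ∃ l : ℤ, ∃ γ ∈ Subgroup.closure (sig n '' {j | j < n - 1}),
      g = conjHom n (n - 1) (lastInner n) (genProd n n) ^ l * γ := by
  obtain ⟨u, hu, γ, hγ, rfl⟩ := exists_mul_of_mem_sup (isTypeB_lastInner n)
    (conjSubgroup_sup_closure hn ▸ Subgroup.mem_top g)
  obtain ⟨w, rfl⟩ := conjSubgroup_le_range (by omega) hu
  -- The full product is fixed by `γ` and by `u * γ`, hence by conjugation by `w`.
  have h1 : act γ (w⁻¹ * genProd n n * w) = act γ (genProd n n) := by
    rw [← act_conjHom_lastInner (by omega), ← act_mul, hg, act_genProd hγ]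
  have h2 : Commute w (genProd n n) := by
    have := (act γ).injective h1
    rw [mul_assoc, inv_mul_eq_iff_eq_mul] at this
    exact this.symm
  obtain ⟨m, rfl⟩ : ∃ m, n = m + 1 := ⟨n - 1, by omega⟩
  obtain ⟨l, rfl⟩ := mem_zpowers_genProd (Nat.lt_succ_self m) h2
  exact ⟨l, γ, hγ, by simp only [map_zpow]⟩

theorem act_zeta_pow (hn : n ≠ 0) (w : Fn n) : act (zeta n ^ n) w = w := by
  have h1 : ∀ l i : ℕ, act (zeta n ^ l) (gen n i) = gen n (i + l) := fun l i => by
    induction l with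
    | zero => simp [act_one]
    | succ l ih => rw [pow_succ, act_mul, ih, act_zeta, add_assoc]
  have : (act (zeta n ^ n)).toMonoidHom = MonoidHom.id _ :=
    hom_ext_gen hn fun j _ => (h1 n j).trans (by simp [gen])
  exact DFunLike.congr_fun this w

theorem mem_ker_iff_act {g : CircularBraidGroup n} : g ∈ (rhoCB n).ker ↔ ∀ w, act g w = w := by
  rw [MonoidHom.mem_ker, ← MulOpposite.unop_inj]
  exact MulEquiv.ext_iff

end CircularBraidGroup

open CircularBraidGroup in
theorem theorem2p1 (n : ℕ) (hn : 2 ≤ n) :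
    (rhoCB n).ker = Subgroup.zpowers (CircularBraidGroup.zeta n ^ n) := by
  have hz : zeta n ^ n ∈ (rhoCB n).ker := mem_ker_iff_act.mpr (act_zeta_pow (by omega))
  refine le_antisymm (fun g hg => ?_) (by rwa [Subgroup.zpowers_le])
  obtain ⟨l, γ, hγ, hl⟩ := exists_eq_mul_of_act_eq hn (mem_ker_iff_act.mp hg)
  refine ⟨l, ?_⟩
  have hker : g * ((zeta n ^ n) ^ l)⁻¹ ∈ (rhoCB n).ker := mul_mem hg (inv_mem (zpow_mem hz l))
  obtain ⟨l', γ', hγ', hl'⟩ := exists_eq_mul_of_act_eq hn (mem_ker_iff_act.mp hker)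
  have hw := congrArg (winding n) hl'
  -- The winding numbers give `n * l' = n * l - n * l = 0`.
  have hl0 : l' = 0 := by
    rw [hl] at hw
    simp only [map_mul, map_zpow, map_inv, map_pow, winding_of_mem_closure hγ,
      winding_of_mem_closure hγ', winding_conjHom_genProd le_rfl, winding_zeta] at hw
    have := congrArg Multiplicative.toAdd hw
    simp at this
    omega
  rw [hl0, zpow_zero, one_mul] at hl'
  have : γ' = 1 := eq_one_of_act_eq_one (by omega) hγ' (hl' ▸ mem_ker_iff_act.mp hker)
  rw [this, mul_inv_eq_one] at hl'
  exact hl'.symm
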